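/- Let $\alpha>2$, $0<\varphi\le 2\pi$, $\lambda>0$, and let $\Phi=\{x_i\}_{i\in\mathbb N}$ be a homogeneous Poisson point process on $\mathbb{R}^2$ with intensity $\lambda$. Let $(h_i)_{i\in\mathbb N}$ be i.i.d. almost surely positive random variables (channel gains), independent of $\Phi$, distributed as $h$ with $E[h^{2/\alpha}]<\infty$. Fix a receiver $x\in\mathbb{R}^2$ that hears exactly the nodes $x_i$ for which the angle in $[0,2\pi)$ from the horizontal axis to $x_i-x$ is at most $\varphi$. Let $z_1<z_2<\cdots$ be the values $z=\|x-x_i\|^{\alpha}/h_i$ of the heard nodes in increasing order, so that $I_k=z_k^{-1}$ is the $k$-th largest (dominant) interference power $h_i\|x-x_i\|^{-\alpha}$ at $x$. For $n\ge 1$ let $$\mathcal I(n)=\sum_{k=n+1}^{\infty} I_k=\sum_{k=n+1}^\infty z_k^{-1}$$ be the partial accumulative interference without the first $n$ dominant interferers. If $n+1>\alpha/2$, then $$E[\mathcal I(n)]=\frac{2}{\alpha-2}\left(\frac{E[h^{2/\alpha}]\,\varphi\,\lambda}{2}\right)^{\alpha/2}\frac{\Gamma(n+1-\alpha/2)}{\Gamma(n)}.$$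 In particular this mean is finite. -/

import Mathlib

open MeasureTheory ProbabilityTheory

noncomputable section

/-- The Euclidean plane. -/
abbrev Plane : Type := EuclideanSpace ℝ (Fin 2)

/-- The number of points of the (random) family `X 0 ω, X 1 ω, …` that lie in `B`. -/
def pointCount {Ω E : Type*} (X : ℕ → Ω → E) (B : Set E) (ω : Ω) : ℕ∞ :=
  {i : ℕ | X i ω ∈ B}.encard

/-- The random points `X 0, X 1, …` form a Poisson point process with intensity measure `Λ`:
the number of points in a set of finite intensity is Poisson distributed with parameter `Λ B`,
and the numbers of points in disjoint sets are independent. -/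
structure IsPoissonPointProcess {Ω E : Type*} [MeasurableSpace Ω] [MeasurableSpace E]
    (X : ℕ → Ω → E) (Λ : Measure E) (P : Measure Ω) : Prop where
  measurable_point : ∀ i, Measurable (X i)
  hasLaw_count : ∀ B : Set E, MeasurableSet B → Λ B ≠ ⊤ →
    HasLaw (pointCount X B) ((poissonMeasure (Λ B).toNNReal).map (Nat.cast : ℕ → ℕ∞)) P
  indep_count : ∀ (m : ℕ) (B : Fin m → Set E), (∀ j, MeasurableSet (B j)) →
    Pairwise (fun j k => Disjoint (B j) (B k)) → iIndepFun (fun j => pointCount X (B j)) P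

/-- The angle in `[0, 2π)` from the horizontal axis to the vector `v`. -/
def polarAngle (v : Plane) : ℝ :=
  toIcoMod Real.two_pi_pos 0 (Complex.arg ⟨v 0, v 1⟩)

/-- The (indices of the) nodes heard by a receiver at `x` with reception angle `φ`. -/
def receivedNodes (φ : ℝ) (x : Plane) (p : ℕ → Plane) : Set ℕ :=
  {i | polarAngle (p i - x) ≤ φ}

/-- The inverse interference power `‖x - pᵢ‖ ^ α / hᵢ` of node `i` at the receiver `x`. -/
def inversePower (α : ℝ) (x : Plane) (p : ℕ → Plane) (h : ℕ → ℝ) (i : ℕ) : ℝ :=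
  ‖x - p i‖ ^ α / h i

/-- The `n`-th smallest value (`n = 1, 2, …`) of the family `(z i)`, `i ∈ J`, i.e. the least `t`
for which at least `n` members of the family are `≤ t`. -/
def nthSmallest (J : Set ℕ) (z : ℕ → ℝ) (n : ℕ) : ℝ :=
  sInf {t : ℝ | (n : ℕ∞) ≤ {i ∈ J | z i ≤ t}.encard}

/-- If the family can be listed in strictly increasing order, then `nthSmallest` returns the
terms of that list. -/
theorem nthSmallest_eq_of_strictMono {J : Set ℕ} {z : ℕ → ℝ} {e : ℕ → ℕ}
    (he : Set.BijOn e Set.univ J) (hz : StrictMono fun k => z (e k)) (k : ℕ) :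
    nthSmallest J z (k + 1) = z (e k) := by
  have key : {t : ℝ | ((k + 1 : ℕ) : ℕ∞) ≤ {i ∈ J | z i ≤ t}.encard} = Set.Ici (z (e k)) := by
    ext t
    simp only [Set.mem_ofPred_eq, Set.mem_Ici]
    have himg : {i ∈ J | z i ≤ t} = e '' {j | z (e j) ≤ t} := by
      ext i
      constructor
      · rintro ⟨hi, hit⟩
        obtain ⟨j, -, rfl⟩ := he.surjOn hi
        exact ⟨j, hit, rfl⟩
      · rintro ⟨j, hj, rfl⟩
        exact ⟨he.mapsTo (Set.mem_univ j), hj⟩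
    have hinj : Function.Injective e := Set.injOn_univ.mp he.injOn
    rw [himg, hinj.encard_image]
    constructor
    · intro hk
      by_contra! hlt
      have hsub : {j | z (e j) ≤ t} ⊆ (Finset.range k : Set ℕ) := by
        intro j hj
        have : z (e j) < z (e k) := lt_of_le_of_lt hj hlt
        simpa using hz.lt_iff_lt.mp this
      have h1 := hk.trans (Set.encard_le_encard hsub)
      rw [Set.encard_coe_eq_coe_finsetCard, Finset.card_range, Nat.cast_le] at h1
      omega
    · intro hk
      have hsub : (Finset.range (k + 1) : Set ℕ) ⊆ {j | z (e j) ≤ t} := by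
        intro j hj
        have hj' : j ≤ k := by simpa [Nat.lt_succ_iff] using hj
        exact (hz.monotone hj').trans hk
      have h1 := Set.encard_le_encard hsub
      rwa [Set.encard_coe_eq_coe_finsetCard, Finset.card_range] at h1
  rw [nthSmallest, key, csInf_Ici]

/-- The `n`-th dominant interference power at `x` (`n = 1, 2, …`): the inverse of the `n`-th
smallest inverse power among the received nodes. -/
def dominantInterference (α φ : ℝ) (x : Plane) (p : ℕ → Plane) (h : ℕ → ℝ) (n : ℕ) : ℝ :=
  (nthSmallest (receivedNodes φ x p) (inversePower α x p h) n)⁻¹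

/-- The partial accumulative interference: the sum of all the dominant interference powers but
the first `n`, as an extended nonnegative number. -/
def partialInterference (α φ : ℝ) (x : Plane) (p : ℕ → Plane) (h : ℕ → ℝ) (n : ℕ) : ENNReal :=
  ∑' k : ℕ, ENNReal.ofReal (dominantInterference α φ x p h (n + 1 + k))

end

open MeasureTheory ProbabilityTheory

noncomputable section

/-!
A node at `p` with gain `m` has inverse power at most `t` iff it lies within distance
`(t * m) ^ α⁻¹` of the receiver. Marking `Φ` by the gains and averaging the areas of the
corresponding sectors, the number `N t` of heard nodes of inverse power at most `t` is Poisson with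
mean `c * t ^ (2 / α)`, where `c = E[h ^ (2 / α)] * φ * λ / 2`. The marking theorem itself follows
from the Laplace functional of `Φ`, by comparing probability generating functions.

The inverse powers `z k` are the arrival times of `N`. Since `1 / z k` is the integral of `t ^ (-2)`
over `t ≥ z k`, Tonelli turns `E[∑ k > n, 1 / z k]` into `∫ t ^ (-2) * ∑ k > n, P(N t ≥ k) dt`. As
`P(Poisson u ≥ k + 1)` has derivative `P(Poisson u = k)` in `u`, two integrations by parts in
`u = c * t ^ (2 / α)` reduce this to a Gamma integral. The first one trades the sum of tails for the
single tail `P(Poisson u ≥ n)`, which is `O(u ^ n)` at `0`; hence the condition `α / 2 < n + 1`.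
-/

open Filter Topology
open scoped ENNReal NNReal

section InfiniteProducts

variable {ι κ : Type*}

theorem tprod_finsetProd_of_le_one {f : κ → ι → ℝ≥0∞} (s : Finset κ) (hf : ∀ k i, f k i ≤ 1) :
    ∏' i, ∏ k ∈ s, f k i = ∏ k ∈ s, ∏' i, f k i := by
  refine HasProd.tprod_eq ?_
  simp only [HasProd, Finset.prod_comm (t := s)]
  refine ENNReal.tendsto_finsetProd_of_ne_top _ (fun k _ => ?_) fun k _ => ?_
  · exact (ENNReal.multipliable_of_le_one (hf k)).hasProd
  · exact ((tprod_le_one (hf k)).trans_lt ENNReal.one_lt_top).ne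

theorem iInf_finsetProd_of_antitone [Preorder κ] [IsDirectedOrder κ] [Nonempty κ]
    {f : κ → ι → ℝ≥0∞} (s : Finset ι) (hf : Antitone f) (hf1 : ∀ k i, f k i ≤ 1) :
    ⨅ k, ∏ i ∈ s, f k i = ∏ i ∈ s, ⨅ k, f k i := by
  have hanti : Antitone fun k => ∏ i ∈ s, f k i := fun _ _ hkl =>
    Finset.prod_le_prod' fun i _ => hf hkl i
  refine tendsto_nhds_unique (tendsto_atTop_iInf hanti) ?_
  refine ENNReal.tendsto_finsetProd_of_ne_top _
    (fun i _ => tendsto_atTop_iInf fun _ _ hkl => hf hkl i) fun i _ => ?_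
  exact ((iInf_le _ (Classical.arbitrary κ)).trans_lt ((hf1 _ i).trans_lt ENNReal.one_lt_top)).ne

theorem iInf_tprod_of_antitone [Preorder κ] [IsDirectedOrder κ] [Nonempty κ]
    {f : κ → ι → ℝ≥0∞} (hf : Antitone f) (hf1 : ∀ k i, f k i ≤ 1) :
    ⨅ k, ∏' i, f k i = ∏' i, ⨅ k, f k i := by
  have hinf : ∀ i, ⨅ k, f k i ≤ 1 := fun i =>
    (iInf_le _ (Classical.arbitrary κ)).trans (hf1 _ i)
  simp only [ENNReal.tprod_eq_iInf_prod (hf1 _), ENNReal.tprod_eq_iInf_prod hinf]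
  rw [iInf_comm]
  exact iInf_congr fun s => iInf_finsetProd_of_antitone s hf hf1

theorem tendsto_tprod_of_antitone [Preorder κ] [IsDirectedOrder κ] [Nonempty κ]
    {f : κ → ι → ℝ≥0∞} (hf : Antitone f) (hf1 : ∀ k i, f k i ≤ 1) :
    Antitone (fun k => ∏' i, f k i) ∧
      Tendsto (fun k => ∏' i, f k i) atTop (𝓝 (∏' i, ⨅ k, f k i)) := by
  have hanti : Antitone fun k => ∏' i, f k i := fun _ _ hkl =>
    (ENNReal.multipliable_of_le_one (hf1 _)).tprod_le_tprod (fun i => hf hkl i)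
      (ENNReal.multipliable_of_le_one (hf1 _))
  exact ⟨hanti, iInf_tprod_of_antitone hf hf1 ▸ tendsto_atTop_iInf hanti⟩

variable {Ω : Type*} [MeasurableSpace Ω]

theorem lintegral_tprod_of_iIndepFun [Countable ι] {P : Measure Ω} {Y : ι → Ω → ℝ≥0∞}
    (hY : ∀ i, Measurable (Y i)) (hY1 : ∀ i ω, Y i ω ≤ 1) (hindep : iIndepFun Y P) :
    ∫⁻ ω, ∏' i, Y i ω ∂P = ∏' i, ∫⁻ ω, Y i ω ∂P := by
  have := hindep.isProbabilityMeasure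
  have hint : ∀ i, ∫⁻ ω, Y i ω ∂P ≤ 1 := fun i => by
    simpa using lintegral_mono (μ := P) (hY1 i)
  have hprod1 : ∀ (s : Finset ι) ω, ∏ i ∈ s, Y i ω ≤ 1 := fun s ω =>
    Finset.prod_le_one' fun i _ => hY1 i ω
  simp only [ENNReal.tprod_eq_iInf_prod hint,
    fun ω => ENNReal.tprod_eq_iInf_prod fun i => hY1 i ω,
    ← lintegral_prod_eq_prod_lintegral_of_indepFun _ _ hindep hY]
  refine lintegral_iInf_directed_of_measurable (IsProbabilityMeasure.ne_zero P)
    (fun s => Finset.measurable_fun_prod s fun i _ => hY i) (fun s => ?_) ?_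
  · exact ((lintegral_mono (hprod1 s)).trans_lt (by simp)).ne
  · exact Antitone.directed_ge fun s t hst ω =>
      Finset.prod_le_prod_of_subset_of_le_one' hst fun i _ _ => hY1 i ω

end InfiniteProducts

/-- The power `s ^ N` of some `s ≤ 1` with a possibly infinite exponent `N`, defined as the infimum
of the powers with finite exponent at most `N`. -/
def powENat (s : ℝ≥0∞) (N : ℕ∞) : ℝ≥0∞ := ⨅ (n : ℕ) (_ : (n : ℕ∞) ≤ N), s ^ n

section PowENat

variable {s : ℝ≥0∞}

theorem powENat_natCast (hs : s ≤ 1) (k : ℕ) : powENat s k = s ^ k :=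
  le_antisymm (iInf₂_le_of_le k le_rfl le_rfl) <| le_iInf₂ fun _ hn =>
    pow_le_pow_of_le_one zero_le hs (Nat.cast_le.1 hn)

theorem powENat_top (hs : s < 1) : powENat s ⊤ = 0 :=
  le_antisymm (ge_of_tendsto' (ENNReal.tendsto_pow_atTop_nhds_zero_of_lt_one hs) fun n =>
    iInf₂_le n le_top) zero_le

theorem powENat_le_one (s : ℝ≥0∞) (N : ℕ∞) : powENat s N ≤ 1 :=
  iInf₂_le_of_le 0 zero_le (pow_zero s).le

theorem one_powENat (N : ℕ∞) : powENat 1 N = 1 :=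
  le_antisymm (powENat_le_one 1 N) <| le_iInf₂ fun n _ => (one_pow n).ge

theorem tprod_const_eq_powENat (ι : Type*) (hs : s ≤ 1) :
    ∏' _ : ι, s = powENat s (ENat.card ι) := by
  rw [ENNReal.tprod_eq_iInf_prod fun _ => hs]
  simp only [Finset.prod_const]
  refine le_antisymm (le_iInf₂ fun n hn => ?_) (le_iInf fun F => iInf₂_le _ ?_)
  · rw [← Set.encard_univ] at hn
    obtain ⟨t, -, ht⟩ := Set.exists_subset_encard_eq hn
    obtain ⟨F, rfl⟩ := (Set.finite_of_encard_eq_coe ht).exists_finset_coe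
    rw [Set.encard_coe_eq_coe_finsetCard, Nat.cast_inj] at ht
    exact iInf_le_of_le F (by rw [ht])
  · rw [← Set.encard_coe_eq_coe_finsetCard, ← Set.encard_univ]
    exact Set.encard_le_encard (Set.subset_univ _)

end PowENat

section GeneratingFunctions

theorem lintegral_powENat_poissonMeasure {q : ℝ≥0∞} (hq : q ≤ 1) (r : ℝ≥0) :
    ∫⁻ N, powENat (1 - q) N ∂Po(ℕ∞, r) = ENNReal.ofReal (Real.exp (-(q * r).toReal)) := by
  lift q to ℝ≥0 using (hq.trans_lt ENNReal.one_lt_top).ne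
  have hq' : (q : ℝ) ≤ 1 := by exact_mod_cast hq
  have hsum : HasSum (fun n : ℕ => Real.exp (-r) * ((r * (1 - q)) ^ n / n.factorial))
      (Real.exp (-r) * Real.exp (r * (1 - q))) := by
    rw [Real.exp_eq_exp_ℝ]
    exact (NormedSpace.expSeries_div_hasSum_exp (r * (1 - q) : ℝ)).mul_left _
  have hterm : ∀ n : ℕ, 0 ≤ Real.exp (-r) * ((r * (1 - q)) ^ n / n.factorial) := fun n => by
    have := sub_nonneg.2 hq'
    positivity
  calc ∫⁻ N, powENat (1 - q) N ∂Po(ℕ∞, r)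
      = ∑' n : ℕ, (1 - q : ℝ≥0∞) ^ n * Po(r) {n} := by
        rw [lintegral_map .of_discrete .of_discrete, lintegral_countable']
        simp only [powENat_natCast tsub_le_self]
    _ = ∑' n : ℕ, ENNReal.ofReal (Real.exp (-r) * ((r * (1 - q)) ^ n / n.factorial)) := by
        refine tsum_congr fun n => ?_
        rw [poissonMeasure_singleton, ← ENNReal.ofReal_coe_nnreal, ← ENNReal.ofReal_one,
          ← ENNReal.ofReal_sub _ q.coe_nonneg, ← ENNReal.ofReal_pow (sub_nonneg.2 hq'),
          ← ENNReal.ofReal_mul (pow_nonneg (sub_nonneg.2 hq') n), mul_pow]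
        ring_nf
    _ = ENNReal.ofReal (Real.exp (-(q * r : ℝ≥0∞).toReal)) := by
        rw [← ENNReal.ofReal_tsum_of_nonneg hterm hsum.summable, hsum.tsum_eq, ← Real.exp_add,
          ENNReal.toReal_mul, ENNReal.coe_toReal, ENNReal.coe_toReal]
        ring_nf

theorem lintegral_powENat_eq_tsum (μ : Measure ℕ∞) {s : ℝ≥0∞} (hs : s < 1) :
    ∫⁻ N, powENat s N ∂μ = ∑' k : ℕ, s ^ k * μ {(k : ℕ∞)} := by
  rw [lintegral_countable', ← Nat.cast_injective.tsum_eq (g := (Nat.cast : ℕ → ℕ∞))]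
  · simp only [powENat_natCast hs.le]
  · intro N hN
    induction N using ENat.recTopCoe with
    | top => simp [powENat_top hs] at hN
    | coe k => exact ⟨k, rfl⟩

theorem eq_zero_of_frequently_hasSum_mul_pow_eq_zero {𝕜 : Type*} [NontriviallyNormedField 𝕜]
    [CompleteSpace 𝕜] {c : ℕ → 𝕜} (h : ∃ᶠ s in 𝓝[≠] 0, HasSum (fun k => c k * s ^ k) 0) :
    c = 0 := by
  let p := FormalMultilinearSeries.ofScalars 𝕜 c
  obtain ⟨r, hr, hr0⟩ := (h.and_eventually self_mem_nhdsWithin).exists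
  have hradius : 0 < p.radius := by
    refine (ENNReal.coe_pos.2 (nnnorm_pos.2 hr0)).trans_le
      (p.le_radius_of_tendsto (l := 0) ?_)
    simpa [p] using hr.summable.tendsto_atTop_zero.norm
  have hp := (p.hasFPowerSeriesOnBall hradius).hasFPowerSeriesAt
  have hzero : ∃ᶠ s in 𝓝[≠] 0, p.sum s = 0 := h.mono fun s hs => by
    simpa [p, FormalMultilinearSeries.sum, mul_comm] using hs.tsum_eq
  exact (FormalMultilinearSeries.ofScalars_series_eq_zero 𝕜).1 <|
    hp.eq_zero_of_eventually (hp.analyticAt.frequently_zero_iff_eventually_zero.1 hzero)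

theorem ext_of_forall_measure_natCast {μ ν : Measure ℕ∞} [IsFiniteMeasure μ]
    (huniv : μ Set.univ = ν Set.univ) (hnat : ∀ k : ℕ, μ {(k : ℕ∞)} = ν {(k : ℕ∞)}) : μ = ν := by
  have hrange : μ (Set.range Nat.cast) = ν (Set.range Nat.cast) := by
    simp only [← Set.iUnion_singleton_eq_range, hnat, measure_iUnion
      (fun j k hjk => by simpa using hjk : Pairwise (Function.onFun Disjoint fun k : ℕ =>
        ({(k : ℕ∞)} : Set ℕ∞))) fun _ => .of_discrete]
  have htop : ({⊤} : Set ℕ∞) = (Set.range Nat.cast)ᶜ := by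
    ext N
    induction N using ENat.recTopCoe <;> simp
  refine Measure.ext_of_singleton fun N => ?_
  induction N using ENat.recTopCoe with
  | coe k => exact hnat k
  | top =>
    rw [htop, measure_compl .of_discrete (measure_ne_top μ _),
      measure_compl .of_discrete (hrange ▸ measure_ne_top μ _), huniv, hrange]

theorem hasSum_toReal_lintegral_powENat (μ : Measure ℕ∞) [IsFiniteMeasure μ] {s : ℝ}
    (hs : s ∈ Set.Ioo 0 1) :
    HasSum (fun k : ℕ => μ.real {(k : ℕ∞)} * s ^ k)
      (∫⁻ N, powENat (ENNReal.ofReal s) N ∂μ).toReal := by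
  have hfin : ∫⁻ N, powENat (ENNReal.ofReal s) N ∂μ ≠ ⊤ :=
    ((lintegral_mono fun N => powENat_le_one _ N).trans_lt (by simp)).ne
  rw [lintegral_powENat_eq_tsum μ (by simpa using hs.2)] at hfin ⊢
  rw [ENNReal.tsum_toReal_eq (ENNReal.ne_top_of_tsum_ne_top hfin)]
  convert! ENNReal.hasSum_toReal hfin using 2 with k
  rw [ENNReal.toReal_mul, ENNReal.toReal_pow, ENNReal.toReal_ofReal hs.1.le, mul_comm]
  rfl

theorem ext_of_lintegral_powENat {μ ν : Measure ℕ∞} [IsFiniteMeasure μ] [IsFiniteMeasure ν]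
    (h : ∀ s ≤ 1, ∫⁻ N, powENat s N ∂μ = ∫⁻ N, powENat s N ∂ν) : μ = ν := by
  refine ext_of_forall_measure_natCast (by simpa [one_powENat] using h 1 le_rfl) fun k => ?_
  have hsum : ∀ᶠ s in 𝓝[>] (0 : ℝ),
      HasSum (fun k : ℕ => (μ.real {(k : ℕ∞)} - ν.real {(k : ℕ∞)}) * s ^ k) 0 := by
    filter_upwards [Ioo_mem_nhdsGT one_pos] with s hs
    have hdiff := (hasSum_toReal_lintegral_powENat μ hs).sub (hasSum_toReal_lintegral_powENat ν hs)
    rw [h _ (by simpa using hs.2.le), sub_self] at hdiff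
    simpa only [sub_mul] using hdiff
  have hcoeff := eq_zero_of_frequently_hasSum_mul_pow_eq_zero <|
    hsum.frequently.filter_mono (nhdsWithin_mono 0 fun s (hs : 0 < s) => hs.ne')
  exact (measureReal_eq_measureReal_iff).1 (sub_eq_zero.1 (congrFun hcoeff k))

end GeneratingFunctions

theorem lintegral_one_sub {F : Type*} [MeasurableSpace F] (μ : Measure F) [IsProbabilityMeasure μ]
    {q : F → ℝ≥0∞} (hq : Measurable q) (hq1 : ∀ y, q y ≤ 1) :
    ∫⁻ y, (1 - q y) ∂μ = 1 - ∫⁻ y, q y ∂μ := by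
  rw [lintegral_sub hq ?_ (ae_of_all _ hq1), lintegral_one, measure_univ]
  exact ne_top_of_le_ne_top (by simp) (lintegral_mono hq1)

theorem lintegral_comp_of_indepFun {Ω E F : Type*} [MeasurableSpace Ω] [MeasurableSpace E]
    [MeasurableSpace F] {P : Measure Ω} [IsFiniteMeasure P] {X : Ω → E} {Y : Ω → F}
    (hXY : IndepFun X Y P) (hX : Measurable X) (hY : Measurable Y) {f : E → F → ℝ≥0∞}
    (hf : Measurable (Function.uncurry f)) :
    ∫⁻ ω, f (X ω) (Y ω) ∂P = ∫⁻ ω, ∫⁻ ω', f (X ω) (Y ω') ∂P ∂P := by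
  have hmap := (indepFun_iff_map_prod_eq_prod_map_map hX.aemeasurable hY.aemeasurable).1 hXY
  calc ∫⁻ ω, f (X ω) (Y ω) ∂P
      = ∫⁻ z, Function.uncurry f z ∂(P.map X).prod (P.map Y) := by
        rw [← hmap, lintegral_map hf (hX.prodMk hY)]; rfl
    _ = ∫⁻ x, ∫⁻ y, f x y ∂P.map Y ∂P.map X := lintegral_prod _ hf.aemeasurable
    _ = ∫⁻ ω, ∫⁻ y, f (X ω) y ∂P.map Y ∂P := lintegral_map hf.lintegral_prod_right' hX
    _ = _ := lintegral_congr fun ω => lintegral_map (hf.comp measurable_prodMk_left) hY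

section PoissonPointProcess

variable {Ω E F : Type*} (X : ℕ → Ω → E)

theorem powENat_pointCount (B : Set E) (q : ℝ≥0∞) (ω : Ω) :
    powENat (1 - q) (pointCount X B ω) = ∏' i, (1 - B.indicator (fun _ => q) (X i ω)) := by
  classical
  calc powENat (1 - q) (pointCount X B ω)
      = ∏' _ : {i | X i ω ∈ B}, (1 - q) := (tprod_const_eq_powENat _ tsub_le_self).symm
    _ = ∏' i, {i | X i ω ∈ B}.mulIndicator (fun _ => 1 - q) i := tprod_subtype _ fun _ => 1 - q
    _ = _ := tprod_congr fun i => by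
        by_cases hi : X i ω ∈ B <;> simp [Set.mulIndicator, hi]

variable [MeasurableSpace E]

theorem tprod_one_sub_simpleFunc (g : SimpleFunc E ℝ≥0∞) (ω : Ω) :
    ∏' i, (1 - g (X i ω)) = ∏ y ∈ g.range, powENat (1 - y) (pointCount X (g ⁻¹' {y}) ω) := by
  simp only [powENat_pointCount]
  rw [← tprod_finsetProd_of_le_one _ fun _ _ => tsub_le_self]
  refine tprod_congr fun i => ?_
  rw [Finset.prod_eq_single_of_mem (g (X i ω)) (g.mem_range_self _)]
  · simp
  · intro y _ hy
    simp [hy.symm]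

variable [MeasurableSpace Ω] [MeasurableSpace F] {X} {Λ : Measure E} {P : Measure Ω}

theorem measurable_pointCount (hX : ∀ i, Measurable (X i)) {B : Set E} (hB : MeasurableSet B) :
    Measurable (pointCount X B) :=
  measurable_encard.comp (measurable_set_iff.2 fun i => measurable_mem.2 (hX i hB))

namespace IsPoissonPointProcess

theorem isProbabilityMeasure (hX : IsPoissonPointProcess X Λ P) : IsProbabilityMeasure P :=
  (hX.indep_count 0 (fun _ => ∅) (fun _ => .empty) fun _ _ _ =>
    Set.disjoint_empty _).isProbabilityMeasure

theorem iIndepFun_pointCount (hX : IsPoissonPointProcess X Λ P) {ι : Type*} {B : ι → Set E}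
    (hB : ∀ j, MeasurableSet (B j)) (hdisj : Pairwise (Function.onFun Disjoint B)) :
    iIndepFun (fun j => pointCount X (B j)) P := by
  refine iIndepFun_iff_finset.2 fun s => ?_
  have hfin := hX.indep_count s.card (fun j => B (s.equivFin.symm j)) (fun j => hB _)
    fun j k hjk => hdisj (Subtype.val_injective.ne (s.equivFin.symm.injective.ne hjk))
  simpa [Finset.restrict_def] using hfin.precomp s.equivFin.injective

theorem lintegral_powENat_pointCount (hX : IsPoissonPointProcess X Λ P) {q : ℝ≥0∞} (hq : q ≤ 1)
    {B : Set E} (hB : MeasurableSet B) (hfin : q * Λ B ≠ ⊤) :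
    ∫⁻ ω, powENat (1 - q) (pointCount X B ω) ∂P =
      ENNReal.ofReal (Real.exp (-(q * Λ B).toReal)) := by
  have := hX.isProbabilityMeasure
  obtain rfl | hq0 := eq_or_ne q 0
  · simp [one_powENat]
  have hΛ : Λ B ≠ ⊤ := fun h => hfin (by rw [h, ENNReal.mul_top hq0])
  rw [(hX.hasLaw_count B hB hΛ).lintegral_comp (f := powENat (1 - q)) .of_discrete,
    lintegral_powENat_poissonMeasure hq, ENNReal.coe_toNNReal hΛ]

theorem lintegral_tprod_one_sub_simpleFunc (hX : IsPoissonPointProcess X Λ P)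
    {g : SimpleFunc E ℝ≥0∞} (hg : ∀ p, g p ≤ 1) (hfin : ∫⁻ p, g p ∂Λ ≠ ⊤) :
    ∫⁻ ω, ∏' i, (1 - g (X i ω)) ∂P = ENNReal.ofReal (Real.exp (-(∫⁻ p, g p ∂Λ).toReal)) := by
  rw [g.lintegral_eq_lintegral, SimpleFunc.lintegral] at hfin ⊢
  have hterm : ∀ y ∈ g.range, y * Λ (g ⁻¹' {y}) ≠ ⊤ := fun y hy =>
    (ENNReal.sum_lt_top.1 hfin.lt_top y hy).ne
  have hindep : iIndepFun (fun y ω => powENat (1 - y) (pointCount X (g ⁻¹' {y}) ω)) P :=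
    (hX.iIndepFun_pointCount (fun y => g.measurableSet_preimage {y}) fun y z hyz =>
      Disjoint.preimage g (by simpa using hyz)).comp (fun y => powENat (1 - y)) fun y =>
        .of_discrete
  simp only [tprod_one_sub_simpleFunc]
  rw [lintegral_prod_eq_prod_lintegral_of_indepFun _ _ hindep fun y =>
      (Measurable.of_discrete (f := powENat (1 - y))).comp
        (measurable_pointCount hX.measurable_point (g.measurableSet_preimage {y})),
    ENNReal.toReal_sum hterm, ← Finset.sum_neg_distrib, Real.exp_sum,
    ENNReal.ofReal_prod_of_nonneg fun _ _ => Real.exp_nonneg _]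
  refine Finset.prod_congr rfl fun y hy => ?_
  obtain ⟨p, rfl⟩ := SimpleFunc.mem_range.1 hy
  exact hX.lintegral_powENat_pointCount (hg p) (g.measurableSet_preimage _) (hterm _ hy)

theorem lintegral_tprod_one_sub (hX : IsPoissonPointProcess X Λ P) {q : E → ℝ≥0∞}
    (hq : Measurable q) (hq1 : ∀ p, q p ≤ 1) (hfin : ∫⁻ p, q p ∂Λ ≠ ⊤) :
    ∫⁻ ω, ∏' i, (1 - q (X i ω)) ∂P = ENNReal.ofReal (Real.exp (-(∫⁻ p, q p ∂Λ).toReal)) := by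
  have := hX.isProbabilityMeasure
  let g := SimpleFunc.eapprox q
  have hg_mono : Monotone fun m p => g m p := SimpleFunc.monotone_eapprox q
  have hg_sup : ∀ p, ⨆ m, g m p = q p := SimpleFunc.iSup_eapprox_apply hq
  have hg_le : ∀ m p, g m p ≤ q p := fun m p => hg_sup p ▸ le_iSup (fun m => g m p) m
  have hI_fin : ∀ m, ∫⁻ p, g m p ∂Λ ≠ ⊤ := fun m =>
    ne_top_of_le_ne_top hfin (lintegral_mono (hg_le m))
  have hI_tendsto : Tendsto (fun m => ∫⁻ p, g m p ∂Λ) atTop (𝓝 (∫⁻ p, q p ∂Λ)) := by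
    refine lintegral_tendsto_of_tendsto_of_monotone (fun m => (g m).measurable.aemeasurable)
      (ae_of_all _ fun p m n hmn => hg_mono hmn p) (ae_of_all _ fun p => ?_)
    exact hg_sup p ▸ tendsto_atTop_iSup fun m n hmn => hg_mono hmn p
  have hprod_tendsto : ∀ ω, Antitone (fun m => ∏' i, (1 - g m (X i ω))) ∧
      Tendsto (fun m => ∏' i, (1 - g m (X i ω))) atTop (𝓝 (∏' i, (1 - q (X i ω)))) := fun ω => by
    have hanti : Antitone fun m i => 1 - g m (X i ω) := fun m n hmn i =>
      tsub_le_tsub_left (hg_mono hmn _) 1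
    simpa only [← ENNReal.sub_iSup ENNReal.one_ne_top, hg_sup] using
      tendsto_tprod_of_antitone hanti fun _ _ => tsub_le_self
  have hX_meas := hX.measurable_point
  have hprod_lim := lintegral_tendsto_of_tendsto_of_antitone (μ := P)
    (fun m => by fun_prop) (ae_of_all _ fun ω => (hprod_tendsto ω).1)
    (ne_top_of_le_ne_top (by simp : ∫⁻ _, 1 ∂P ≠ ⊤)
      (lintegral_mono fun ω => tprod_le_one fun _ => tsub_le_self))
    (ae_of_all _ fun ω => (hprod_tendsto ω).2)
  refine tendsto_nhds_unique hprod_lim ?_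
  simp only [fun m => hX.lintegral_tprod_one_sub_simpleFunc
    (fun p => (hg_le m p).trans (hq1 p)) (hI_fin m)]
  exact ENNReal.tendsto_ofReal <| (Real.continuous_exp.tendsto _).comp
    ((ENNReal.tendsto_toReal hfin).comp hI_tendsto).neg

theorem lintegral_tprod_one_sub_mark (hX : IsPoissonPointProcess X Λ P) {h : ℕ → Ω → F}
    {μ : Measure F} [IsProbabilityMeasure μ] (h_meas : ∀ i, Measurable (h i))
    (h_indep : iIndepFun h P) (h_law : ∀ i, HasLaw (h i) μ P)
    (hXh : IndepFun (fun ω i => X i ω) (fun ω i => h i ω) P) {q : E × F → ℝ≥0∞}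
    (hq : Measurable q) (hq1 : ∀ z, q z ≤ 1) (hfin : ∫⁻ z, q z ∂Λ.prod μ ≠ ⊤) :
    ∫⁻ ω, ∏' i, (1 - q (X i ω, h i ω)) ∂P =
      ENNReal.ofReal (Real.exp (-(∫⁻ z, q z ∂Λ.prod μ).toReal)) := by
  have := hX.isProbabilityMeasure
  have hX_meas := hX.measurable_point
  have hmarks : ∀ p : ℕ → E, ∫⁻ ω, ∏' i, (1 - q (p i, h i ω)) ∂P =
      ∏' i, (1 - ∫⁻ y, q (p i, y) ∂μ) := fun p => by
    rw [lintegral_tprod_of_iIndepFun (by fun_prop) (fun _ _ => tsub_le_self)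
      (h_indep.comp (fun i y => 1 - q (p i, y)) (by fun_prop))]
    refine tprod_congr fun i => ?_
    rw [(h_law i).lintegral_comp (f := fun y => 1 - q (p i, y)) (by fun_prop),
      lintegral_one_sub μ (by fun_prop) fun y => hq1 _]
  rw [lintegral_prod _ hq.aemeasurable] at hfin ⊢
  rw [← hX.lintegral_tprod_one_sub hq.lintegral_prod_right'
    (fun p => (lintegral_mono fun y => hq1 (p, y)).trans (by simp)) hfin,
    lintegral_comp_of_indepFun hXh (by fun_prop) (by fun_prop)
      (f := fun p y => ∏' i, (1 - q (p i, y i))) (by fun_prop)]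
  exact lintegral_congr fun ω => hmarks fun i => X i ω

theorem hasLaw_pointCount_mark (hX : IsPoissonPointProcess X Λ P) {h : ℕ → Ω → F}
    {μ : Measure F} [IsProbabilityMeasure μ] (h_meas : ∀ i, Measurable (h i))
    (h_indep : iIndepFun h P) (h_law : ∀ i, HasLaw (h i) μ P)
    (hXh : IndepFun (fun ω i => X i ω) (fun ω i => h i ω) P) {A : Set (E × F)}
    (hA : MeasurableSet A) (hfin : Λ.prod μ A ≠ ⊤) :
    HasLaw (pointCount (fun i ω => (X i ω, h i ω)) A) Po(ℕ∞, (Λ.prod μ A).toNNReal) P := by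
  have := hX.isProbabilityMeasure
  have hcount : Measurable (pointCount (fun i ω => (X i ω, h i ω)) A) :=
    measurable_pointCount (fun i => (hX.measurable_point i).prodMk (h_meas i)) hA
  refine ⟨hcount.aemeasurable, ?_⟩
  have := Measure.isProbabilityMeasure_map (μ := P) hcount.aemeasurable
  refine ext_of_lintegral_powENat fun s hs => ?_
  obtain ⟨q, hq, rfl⟩ : ∃ q ≤ 1, s = 1 - q :=
    ⟨1 - s, tsub_le_self, (ENNReal.sub_sub_cancel ENNReal.one_ne_top hs).symm⟩
  have hint : ∫⁻ z, A.indicator (fun _ => q) z ∂Λ.prod μ = q * Λ.prod μ A :=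
    lintegral_indicator_const hA q
  rw [lintegral_powENat_poissonMeasure hq, ENNReal.coe_toNNReal hfin, ← hint,
    ← hX.lintegral_tprod_one_sub_mark h_meas h_indep h_law hXh (measurable_const.indicator hA)
      (Set.indicator_le' (fun _ _ => hq) fun _ _ => zero_le),
    lintegral_map .of_discrete hcount]
  · simp only [powENat_pointCount]
  · exact hint ▸ ENNReal.mul_ne_top (ne_top_of_le_ne_top ENNReal.one_ne_top hq) hfin

end IsPoissonPointProcess

end PoissonPointProcess

section Sector

theorem measurable_toIcoMod {p : ℝ} (hp : 0 < p) (a : ℝ) : Measurable (toIcoMod hp a) := by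
  simp only [funext (toIcoMod_eq_add_fract_mul hp a)]
  fun_prop

theorem volume_toIcoMod_preimage_inter_Ioc {p : ℝ} (hp : 0 < p) (a b : ℝ) {B : Set ℝ}
    (hB : MeasurableSet B) :
    volume (toIcoMod hp a ⁻¹' B ∩ Set.Ioc b (b + p)) = volume (B ∩ Set.Ico a (a + p)) := by
  calc volume (toIcoMod hp a ⁻¹' B ∩ Set.Ioc b (b + p))
      = volume (toIcoMod hp a ⁻¹' B ∩ Set.Ioc a (a + p)) := by
        refine (isAddFundamentalDomain_Ioc hp b).measure_set_eq (isAddFundamentalDomain_Ioc hp a)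
          (measurable_toIcoMod hp a hB) ?_
        rintro ⟨_, k, rfl⟩
        ext θ
        simp [AddSubgroup.vadd_def]
    _ = volume (toIcoMod hp a ⁻¹' B ∩ Set.Ico a (a + p)) :=
        measure_congr (ae_eq_rfl.inter Ico_ae_eq_Ioc.symm)
    _ = volume (B ∩ Set.Ico a (a + p)) := by
        congr 1
        ext θ
        simp only [Set.mem_inter_iff, Set.mem_preimage, and_congr_left_iff]
        intro hθ
        rw [(toIcoMod_eq_self hp).2 hθ]

theorem volume_arg_mem_norm_le {Θ : Set ℝ} (hΘ : MeasurableSet Θ) {r : ℝ} (hr : 0 ≤ r) :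
    volume {z : ℂ | z.arg ∈ Θ ∧ ‖z‖ ≤ r} =
      ENNReal.ofReal (r ^ 2 / 2) * volume (Θ ∩ Set.Ioc (-Real.pi) Real.pi) := by
  set S := {z : ℂ | z.arg ∈ Θ ∧ ‖z‖ ≤ r}
  have hS : MeasurableSet S :=
    (Complex.measurable_arg hΘ).inter (measurableSet_le measurable_norm measurable_const)
  have hpolar : ∀ w ∈ polarCoord.target,
      ENNReal.ofReal w.1 • S.indicator (1 : ℂ → ℝ≥0∞) (Complex.polarCoord.symm w) =
        (Set.Iic r).indicator ENNReal.ofReal w.1 * Θ.indicator 1 w.2 := by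
    rintro ⟨ρ, θ⟩ ⟨hρ : 0 < ρ, hθ⟩
    have hmem : Complex.polarCoord.symm (ρ, θ) ∈ S ↔ ρ ∈ Set.Iic r ∧ θ ∈ Θ := by
      rw [Set.mem_ofPred_eq, Complex.norm_polarCoord_symm, abs_of_pos hρ,
        Complex.polarCoord_symm_apply, Complex.ofReal_cos, Complex.ofReal_sin,
        Complex.arg_mul_cos_add_sin_mul_I hρ ⟨hθ.1, hθ.2.le⟩, and_comm, Set.mem_Iic]
    by_cases hρr : ρ ∈ Set.Iic r <;> by_cases hθΘ : θ ∈ Θ <;>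
      simp only [Set.indicator, hmem, hρr, hθΘ] <;> simp
  have hradial : ∫⁻ ρ in Set.Ioi 0, (Set.Iic r).indicator ENNReal.ofReal ρ =
      ENNReal.ofReal (r ^ 2 / 2) := by
    rw [setLIntegral_indicator measurableSet_Iic, Set.inter_comm, Set.Ioi_inter_Iic,
      ← ofReal_integral_eq_lintegral_ofReal, ← intervalIntegral.integral_of_le hr, integral_id]
    · simp
    · exact continuous_id.integrableOn_Icc.mono_set Set.Ioc_subset_Icc_self
    · filter_upwards [ae_restrict_mem measurableSet_Ioc] with ρ hρ using hρ.1.le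
  rw [← lintegral_indicator_one hS, ← Complex.lintegral_comp_polarCoord_symm,
    setLIntegral_congr_fun polarCoord.open_target.measurableSet hpolar, polarCoord_target,
    Measure.volume_eq_prod, ← Measure.prod_restrict, lintegral_prod_mul
      (ENNReal.measurable_ofReal.indicator measurableSet_Iic).aemeasurable
      (measurable_one.indicator hΘ).aemeasurable, hradial, lintegral_indicator_one hΘ,
    Measure.restrict_apply hΘ, measure_congr (ae_eq_rfl.inter Ioo_ae_eq_Ioc)]

theorem measurable_polarAngle : Measurable polarAngle := by
  unfold polarAngle
  simp only [Complex.mk_eq_add_mul_I]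
  exact (measurable_toIcoMod _ _).comp (Complex.measurable_arg.comp (by fun_prop))

theorem measurableSet_sector (φ r : ℝ) :
    MeasurableSet {v : Plane | polarAngle v ≤ φ ∧ ‖v‖ ≤ r} :=
  (measurableSet_le measurable_polarAngle measurable_const).inter
    (measurableSet_le measurable_norm measurable_const)

theorem volume_sector {φ r : ℝ} (hφ_le : φ ≤ 2 * Real.pi) (hr : 0 ≤ r) :
    volume {v : Plane | polarAngle v ≤ φ ∧ ‖v‖ ≤ r} = ENNReal.ofReal (φ * r ^ 2 / 2) := by
  have hangle : volume (Set.Iic φ ∩ Set.Ico 0 (0 + 2 * Real.pi)) = ENNReal.ofReal φ := by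
    calc volume (Set.Iic φ ∩ Set.Ico 0 (0 + 2 * Real.pi))
        = volume (Set.Iio φ ∩ Set.Ico 0 (0 + 2 * Real.pi)) :=
          measure_congr (Iio_ae_eq_Iic.symm.inter ae_eq_rfl)
      _ = ENNReal.ofReal φ := by
          rw [Set.inter_comm, Set.Ico_inter_Iio, zero_add, min_eq_right hφ_le, Real.volume_Ico,
            sub_zero]
  have hcomplex : Complex.orthonormalBasisOneI.repr ⁻¹' {v : Plane | polarAngle v ≤ φ ∧ ‖v‖ ≤ r} =
      {z | z.arg ∈ toIcoMod Real.two_pi_pos 0 ⁻¹' Set.Iic φ ∧ ‖z‖ ≤ r} := by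
    ext z
    simp [polarAngle, Complex.orthonormalBasisOneI_repr_apply]
  have hpi : Real.pi = -Real.pi + 2 * Real.pi := by ring
  rw [← Complex.orthonormalBasisOneI.measurePreserving_repr.measure_preimage
      (measurableSet_sector φ r).nullMeasurableSet, hcomplex,
    volume_arg_mem_norm_le (measurable_toIcoMod _ _ measurableSet_Iic) hr]
  nth_rw 3 [hpi]
  rw [volume_toIcoMod_preimage_inter_Ioc _ _ _ measurableSet_Iic, hangle,
    ← ENNReal.ofReal_mul (by positivity)]
  congr 1
  ring

end Sector

section HeardRegion

/-- The marked points `(p, m)` that are heard by a receiver at `x` with reception angle `φ` and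
whose inverse interference power `‖x - p‖ ^ α / m` is at most `t`. -/
def heardRegion (α φ : ℝ) (x : Plane) (t : ℝ) : Set (Plane × ℝ) :=
  {z | polarAngle (z.1 - x) ≤ φ ∧ ‖x - z.1‖ ^ α / z.2 ≤ t}

theorem measurableSet_mem_heardRegion (α φ : ℝ) (x : Plane) :
    MeasurableSet {z : ℝ × (Plane × ℝ) | z.2 ∈ heardRegion α φ x z.1} :=
  (measurableSet_le (measurable_polarAngle.comp (by fun_prop)) measurable_const).inter
    (measurableSet_le (f := fun z : ℝ × (Plane × ℝ) => ‖x - z.2.1‖ ^ α / z.2.2) (by fun_prop)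
      measurable_fst)

theorem measurableSet_heardRegion (α φ : ℝ) (x : Plane) (t : ℝ) :
    MeasurableSet (heardRegion α φ x t) :=
  measurable_prodMk_left (x := t) (measurableSet_mem_heardRegion α φ x)

theorem volume_heardRegion_slice {α φ : ℝ} (hα : 0 < α) (hφ_le : φ ≤ 2 * Real.pi) (x : Plane)
    {t m : ℝ} (ht : 0 ≤ t) (hm : 0 < m) :
    volume ((fun p => (p, m)) ⁻¹' heardRegion α φ x t) =
      ENNReal.ofReal (φ * t ^ (2 / α) / 2 * m ^ (2 / α)) := by
  have htranslate : (fun p => (p, m)) ⁻¹' heardRegion α φ x t =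
      (fun p => p + -x) ⁻¹' {v : Plane | polarAngle v ≤ φ ∧ ‖v‖ ≤ (t * m) ^ α⁻¹} := by
    ext p
    simp only [heardRegion, Set.mem_preimage, Set.mem_ofPred_eq, ← sub_eq_add_neg]
    rw [div_le_iff₀ hm, norm_sub_rev,
      Real.le_rpow_inv_iff_of_pos (norm_nonneg _) (by positivity) hα]
  have hradius : ((t * m) ^ α⁻¹) ^ 2 = t ^ (2 / α) * m ^ (2 / α) := by
    rw [← Real.rpow_mul_natCast (by positivity), Real.mul_rpow ht hm.le, Nat.cast_ofNat,
      inv_mul_eq_div]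
  rw [htranslate, measure_preimage_add_right, volume_sector hφ_le (by positivity), hradius]
  congr 1
  ring

theorem prod_heardRegion {α φ lam : ℝ} (hα : 0 < α) (hφ_pos : 0 < φ) (hφ_le : φ ≤ 2 * Real.pi)
    (x : Plane) (μ : Measure ℝ) [SFinite μ] (hμ : ∀ᵐ m ∂μ, 0 < m)
    (hint : Integrable (fun m : ℝ => m ^ (2 / α)) μ) {t : ℝ} (ht : 0 ≤ t) :
    (ENNReal.ofReal lam • (volume : Measure Plane)).prod μ (heardRegion α φ x t) =
      ENNReal.ofReal ((∫ m, m ^ (2 / α) ∂μ) * φ * lam / 2 * t ^ (2 / α)) := by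
  have hmoment_nonneg : ∀ᵐ m ∂μ, 0 ≤ m ^ (2 / α) := hμ.mono fun m hm => by positivity
  have hmean_nonneg : 0 ≤ ∫ m, m ^ (2 / α) ∂μ := integral_nonneg_of_ae hmoment_nonneg
  have hslice : ∀ᵐ m ∂μ, (ENNReal.ofReal lam • (volume : Measure Plane))
      ((fun p => (p, m)) ⁻¹' heardRegion α φ x t) =
        ENNReal.ofReal lam * ENNReal.ofReal (φ * t ^ (2 / α) / 2) *
          ENNReal.ofReal (m ^ (2 / α)) := by
    filter_upwards [hμ] with m hm
    rw [Measure.smul_apply, volume_heardRegion_slice hα hφ_le x ht hm, smul_eq_mul, mul_assoc,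
      ENNReal.ofReal_mul (by positivity)]
  rw [Measure.prod_apply_symm (measurableSet_heardRegion α φ x t), lintegral_congr_ae hslice,
    lintegral_const_mul' _ _ (ENNReal.mul_ne_top ENNReal.ofReal_ne_top ENNReal.ofReal_ne_top),
    ← ofReal_integral_eq_lintegral_ofReal hint hmoment_nonneg, mul_assoc,
    ← ENNReal.ofReal_mul (by positivity), ← ENNReal.ofReal_mul' (by positivity)]
  congr 1
  ring

end HeardRegion

section PoissonTails

theorem measurable_poissonMeasure_apply (s : Set ℕ) : Measurable fun r : ℝ≥0 => Po(r) s := by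
  simp only [← Measure.tsum_indicator_apply_singleton _ s .of_discrete, poissonMeasure_singleton]
  refine Measurable.tsum fun j => ?_
  by_cases hj : j ∈ s <;> simp only [Set.indicator, hj, if_true, if_false] <;> fun_prop

theorem hasDerivAt_sum_range_exp_neg_mul_pow_div_factorial (k : ℕ) (u : ℝ) :
    HasDerivAt (fun u => ∑ j ∈ Finset.range (k + 1), Real.exp (-u) * u ^ j / j.factorial)
      (-(Real.exp (-u) * u ^ k / k.factorial)) u := by
  induction k with
  | zero => simpa using (hasDerivAt_neg u).exp
  | succ k ih =>
    simp only [Finset.sum_range_succ _ (k + 1)]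
    refine (ih.add ((((hasDerivAt_neg u).exp).mul (hasDerivAt_pow (k + 1) u)).div_const
      ((k + 1).factorial : ℝ))).congr_deriv ?_
    rw [Nat.factorial_succ]
    push_cast
    field_simp
    ring

theorem poissonMeasure_real_Ici_succ (r : ℝ≥0) (k : ℕ) :
    Po(r).real (Set.Ici (k + 1)) =
      1 - ∑ j ∈ Finset.range (k + 1), Real.exp (-r) * (r : ℝ) ^ j / j.factorial := by
  have hcompl : Set.Ici (k + 1) = ((Finset.range (k + 1) : Finset ℕ) : Set ℕ)ᶜ := by
    ext j
    simp
  rw [hcompl, probReal_compl_eq_one_sub .of_discrete, ← sum_measureReal_singleton]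
  simp only [poissonMeasure_real_singleton]

theorem poissonMeasure_Ici_succ (r : ℝ≥0) (k : ℕ) :
    Po(r) (Set.Ici (k + 1)) = ∫⁻ u in Set.Ioc 0 (r : ℝ), Po(u.toNNReal) {k} := by
  have hcont : Continuous fun u : ℝ => Real.exp (-u) * u ^ k / k.factorial := by fun_prop
  have hderiv (u : ℝ) : HasDerivAt
      (fun u => 1 - ∑ j ∈ Finset.range (k + 1), Real.exp (-u) * u ^ j / j.factorial)
      (Real.exp (-u) * u ^ k / k.factorial) u := by
    simpa using (hasDerivAt_sum_range_exp_neg_mul_pow_div_factorial k u).const_sub 1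
  have hzero : ∑ j ∈ Finset.range (k + 1), Real.exp (-0) * (0 : ℝ) ^ j / j.factorial = 1 := by
    rw [Finset.sum_eq_single 0] <;> simp +contextual
  have hFTC : ∫ u in (0 : ℝ)..r, Real.exp (-u) * u ^ k / k.factorial =
      Po(r).real (Set.Ici (k + 1)) := by
    rw [intervalIntegral.integral_eq_sub_of_hasDerivAt (fun u _ => hderiv u)
      (hcont.intervalIntegrable _ _), hzero, sub_self, sub_zero, poissonMeasure_real_Ici_succ]
  have hdensity : ∀ u ∈ Set.Ioc 0 (r : ℝ), Po(u.toNNReal) {k} =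
      ENNReal.ofReal (Real.exp (-u) * u ^ k / k.factorial) := fun u hu => by
    rw [poissonMeasure_singleton, Real.coe_toNNReal _ hu.1.le]
  rw [← ofReal_measureReal, ← hFTC, setLIntegral_congr_fun measurableSet_Ioc hdensity,
    ← ofReal_integral_eq_lintegral_ofReal, ← intervalIntegral.integral_of_le r.coe_nonneg]
  · exact hcont.integrableOn_Icc.mono_set Set.Ioc_subset_Icc_self
  · filter_upwards [ae_restrict_mem measurableSet_Ioc] with u hu
    have := hu.1.le
    positivity

theorem poissonMeasure_Ici_succ_le (r : ℝ≥0) (k : ℕ) : Po(r) (Set.Ici (k + 1)) ≤ r :=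
  calc Po(r) (Set.Ici (k + 1))
      = ∫⁻ u in Set.Ioc 0 (r : ℝ), Po(u.toNNReal) {k} := poissonMeasure_Ici_succ r k
    _ ≤ ∫⁻ _ in Set.Ioc 0 (r : ℝ), 1 := lintegral_mono fun _ => prob_le_one
    _ = r := by simp

theorem tendsto_poissonMeasure_Iio_atTop (k : ℕ) :
    Tendsto (fun r : ℝ≥0 => Po(r) (Set.Iio k)) atTop (𝓝 0) := by
  have hsingleton (j : ℕ) : Tendsto (fun r : ℝ≥0 => Po(r) {j}) atTop (𝓝 0) := by
    have hreal := ((Real.tendsto_pow_mul_exp_neg_atTop_nhds_zero j).div_const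
      (j.factorial : ℝ)).comp (NNReal.tendsto_coe_atTop.2 tendsto_id)
    simpa [poissonMeasure_singleton, mul_comm, Function.comp_def] using
      ENNReal.tendsto_ofReal hreal
  have hsum : ∀ r : ℝ≥0, Po(r) (Set.Iio k) = ∑ j ∈ Finset.range k, Po(r) {j} := fun r => by
    rw [sum_measure_singleton, Finset.coe_range]
  simp only [hsum]
  simpa using tendsto_finsetSum (Finset.range k) fun j _ => hsingleton j

theorem tsum_measure_singleton_add (μ : Measure ℕ) (n : ℕ) :
    ∑' k, μ {n + k} = μ (Set.Ici n) := by
  have hunion : Set.Ici n = ⋃ k, {n + k} := by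
    ext j
    simp [le_iff_exists_add, eq_comm]
  rw [hunion, measure_iUnion (fun j k hjk => by simpa using hjk) fun _ => .of_discrete]

theorem tsum_poissonMeasure_Ici (r : ℝ≥0) (n : ℕ) :
    ∑' k, Po(r) (Set.Ici (n + 1 + k)) =
      ∫⁻ u in Set.Ioc 0 (r : ℝ), Po(u.toNNReal) (Set.Ici n) := by
  simp only [← tsum_measure_singleton_add _ n, add_right_comm n 1, poissonMeasure_Ici_succ]
  exact (lintegral_tsum fun k =>
    ((measurable_poissonMeasure_apply _).comp measurable_real_toNNReal).aemeasurable).symm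

end PoissonTails

section PowerWeights

theorem setLIntegral_Ici_rpow {b s : ℝ} (hb : 0 < b) (hs : 1 < s) :
    ∫⁻ t in Set.Ici b, ENNReal.ofReal (t ^ (-s)) = ENNReal.ofReal (b ^ (1 - s) / (s - 1)) := by
  rw [setLIntegral_congr Ioi_ae_eq_Ici.symm, ← ofReal_integral_eq_lintegral_ofReal,
    integral_Ioi_rpow_of_lt (by linarith) hb]
  · rw [show -s + 1 = -(s - 1) by ring, neg_div_neg_eq, neg_sub]
  · exact integrableOn_Ioi_rpow_of_lt (by linarith) hb
  · filter_upwards [ae_restrict_mem measurableSet_Ioi] with t ht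
    exact Real.rpow_nonneg (hb.trans ht).le _

theorem lintegral_Ioi_lintegral_Ioc_swap {R : ℝ → ℝ} (hR : Measurable R) {G w : ℝ → ℝ≥0∞}
    (hG : Measurable G) (hw : Measurable w) :
    ∫⁻ t in Set.Ioi 0, (∫⁻ u in Set.Ioc 0 (R t), G u) * w t =
      ∫⁻ u in Set.Ioi 0, G u * ∫⁻ t in {t | u ≤ R t} ∩ Set.Ioi 0, w t := by
  set T : Set (ℝ × ℝ) := {z | z.2 ≤ R z.1}
  have hT : MeasurableSet T := measurableSet_le measurable_snd (hR.comp measurable_fst)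
  set H : ℝ → ℝ → ℝ≥0∞ := fun t u => T.indicator (fun z => G z.2 * w z.1) (t, u)
  have hH : Measurable (Function.uncurry H) :=
    ((hG.comp measurable_snd).mul (hw.comp measurable_fst)).indicator hT
  calc _ = ∫⁻ t in Set.Ioi 0, ∫⁻ u in Set.Ioi 0, H t u := by
        refine lintegral_congr fun t => ?_
        change _ = ∫⁻ u in Set.Ioi 0, (Set.Iic (R t)).indicator (fun u => G u * w t) u
        rw [setLIntegral_indicator measurableSet_Iic, Set.inter_comm, Set.Ioi_inter_Iic,
          lintegral_mul_const _ hG]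
    _ = ∫⁻ u in Set.Ioi 0, ∫⁻ t in Set.Ioi 0, H t u := lintegral_lintegral_swap hH.aemeasurable
    _ = _ := by
        refine lintegral_congr fun u => ?_
        change ∫⁻ t in Set.Ioi 0, {t | u ≤ R t}.indicator (fun t => G u * w t) t = _
        rw [setLIntegral_indicator (measurableSet_le measurable_const hR),
          lintegral_const_mul _ hw]

theorem lintegral_lintegral_Ioc_mul_rpow {b c s : ℝ} (hb : 0 < b) (hc : 0 < c) (hs : 1 < s)
    {G : ℝ → ℝ≥0∞} (hG : Measurable G) :
    ∫⁻ t in Set.Ioi 0, (∫⁻ u in Set.Ioc 0 (c * t ^ b), G u) * ENNReal.ofReal (t ^ (-s)) =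
      ∫⁻ u in Set.Ioi 0, G u * ENNReal.ofReal ((u / c) ^ ((1 - s) / b) / (s - 1)) := by
  rw [lintegral_Ioi_lintegral_Ioc_swap (by fun_prop) hG (by fun_prop)]
  refine setLIntegral_congr_fun measurableSet_Ioi fun u (hu : 0 < u) => ?_
  have hset : {t | u ≤ c * t ^ b} ∩ Set.Ioi 0 = Set.Ici ((u / c) ^ b⁻¹) := by
    ext t
    have hpos : 0 < (u / c) ^ b⁻¹ := by positivity
    simp only [Set.mem_inter_iff, Set.mem_ofPred_eq, Set.mem_Ioi, Set.mem_Ici, ← div_le_iff₀' hc]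
    constructor
    · rintro ⟨h, ht⟩
      exact (Real.rpow_inv_le_iff_of_pos (by positivity) ht.le hb).2 h
    · intro h
      have ht := hpos.trans_le h
      exact ⟨(Real.rpow_inv_le_iff_of_pos (by positivity) ht.le hb).1 h, ht⟩
  rw [hset, setLIntegral_Ici_rpow (by positivity) hs, ← Real.rpow_mul (by positivity),
    inv_mul_eq_div]

theorem lintegral_poissonMeasure_singleton_mul_rpow {m : ℕ} {b : ℝ} (hb : 0 < m + 1 + b) :
    ∫⁻ u in Set.Ioi 0, Po(u.toNNReal) {m} * ENNReal.ofReal (u ^ b) =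
      ENNReal.ofReal (Real.Gamma (m + 1 + b) / Real.Gamma (m + 1)) := by
  have hdensity : ∀ u ∈ Set.Ioi (0 : ℝ), Po(u.toNNReal) {m} * ENNReal.ofReal (u ^ b) =
      ENNReal.ofReal (m.factorial : ℝ)⁻¹ *
        ENNReal.ofReal (Real.exp (-u) * u ^ ((m + 1 + b) - 1)) := by
    intro u (hu : 0 < u)
    have hexp : (m + 1 + b) - 1 = m + b := by ring
    rw [poissonMeasure_singleton, Real.coe_toNNReal _ hu.le, ← ENNReal.ofReal_mul (by positivity),
      ← ENNReal.ofReal_mul (by positivity), hexp, Real.rpow_add hu, Real.rpow_natCast]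
    ring_nf
  rw [setLIntegral_congr_fun measurableSet_Ioi hdensity,
    lintegral_const_mul' _ _ ENNReal.ofReal_ne_top,
    ← ofReal_integral_eq_lintegral_ofReal (Real.GammaIntegral_convergent hb),
    ← Real.Gamma_eq_integral hb, ← ENNReal.ofReal_mul (by positivity), Real.Gamma_nat_eq_factorial,
    inv_mul_eq_div]
  filter_upwards [ae_restrict_mem measurableSet_Ioi] with u (hu : 0 < u)
  positivity

theorem lintegral_poissonMeasure_Ici_mul_rpow {n : ℕ} (hn : 1 ≤ n) {a : ℝ} (ha : 1 < a)
    (hna : a < n + 1) :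
    ∫⁻ u in Set.Ioi 0, Po(u.toNNReal) (Set.Ici n) * ENNReal.ofReal (u ^ (-a)) =
      ENNReal.ofReal ((a - 1)⁻¹ * (Real.Gamma (n + 1 - a) / Real.Gamma n)) := by
  obtain ⟨m, rfl⟩ := Nat.exists_eq_add_of_le' hn
  have : 0 < a - 1 := sub_pos.2 ha
  have hm : 0 < m + 1 + (1 - a) := by push_cast at hna; linarith
  have hfubini := lintegral_lintegral_Ioc_mul_rpow one_pos one_pos ha
    ((measurable_poissonMeasure_apply {m}).comp measurable_real_toNNReal)
  simp only [one_mul, Real.rpow_one, div_one, Function.comp_apply] at hfubini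
  calc ∫⁻ u in Set.Ioi 0, Po(u.toNNReal) (Set.Ici (m + 1)) * ENNReal.ofReal (u ^ (-a))
      = ∫⁻ u in Set.Ioi 0,
          (∫⁻ v in Set.Ioc 0 u, Po(v.toNNReal) {m}) * ENNReal.ofReal (u ^ (-a)) :=
        setLIntegral_congr_fun measurableSet_Ioi fun u (hu : 0 < u) => by
          rw [poissonMeasure_Ici_succ, Real.coe_toNNReal _ hu.le]
    _ = ∫⁻ v in Set.Ioi 0, Po(v.toNNReal) {m} * ENNReal.ofReal (v ^ (1 - a) / (a - 1)) := hfubini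
    _ = ENNReal.ofReal (a - 1)⁻¹ *
          ∫⁻ v in Set.Ioi 0, Po(v.toNNReal) {m} * ENNReal.ofReal (v ^ (1 - a)) := by
        rw [← lintegral_const_mul' _ _ ENNReal.ofReal_ne_top]
        refine lintegral_congr fun v => ?_
        rw [div_eq_inv_mul, ENNReal.ofReal_mul (by positivity), mul_left_comm]
    _ = _ := by
        rw [lintegral_poissonMeasure_singleton_mul_rpow hm, ← ENNReal.ofReal_mul (by positivity)]
        push_cast
        rw [add_sub_assoc]

theorem lintegral_tsum_poissonMeasure_Ici_mul_rpow {n : ℕ} (hn : 1 ≤ n) {a c : ℝ} (ha : 1 < a)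
    (hna : a < n + 1) (hc : 0 < c) :
    ∫⁻ t in Set.Ioi 0, (∑' k, Po((c * t ^ a⁻¹).toNNReal) (Set.Ici (n + 1 + k))) *
        ENNReal.ofReal (t ^ (-2 : ℝ)) =
      ENNReal.ofReal (c ^ a * ((a - 1)⁻¹ * (Real.Gamma (n + 1 - a) / Real.Gamma n))) := by
  have : 0 < a := one_pos.trans ha
  calc ∫⁻ t in Set.Ioi 0, (∑' k, Po((c * t ^ a⁻¹).toNNReal) (Set.Ici (n + 1 + k))) *
        ENNReal.ofReal (t ^ (-2 : ℝ))
      = ∫⁻ t in Set.Ioi 0, (∫⁻ u in Set.Ioc 0 (c * t ^ a⁻¹), Po(u.toNNReal) (Set.Ici n)) *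
          ENNReal.ofReal (t ^ (-2 : ℝ)) :=
        setLIntegral_congr_fun measurableSet_Ioi fun t (ht : 0 < t) => by
          rw [tsum_poissonMeasure_Ici, Real.coe_toNNReal _ (by positivity)]
    _ = ∫⁻ u in Set.Ioi 0, Po(u.toNNReal) (Set.Ici n) *
          ENNReal.ofReal ((u / c) ^ ((1 - 2) / a⁻¹) / (2 - 1)) :=
        lintegral_lintegral_Ioc_mul_rpow (by positivity) hc one_lt_two
          ((measurable_poissonMeasure_apply _).comp measurable_real_toNNReal)
    _ = ENNReal.ofReal (c ^ a) *
          ∫⁻ u in Set.Ioi 0, Po(u.toNNReal) (Set.Ici n) * ENNReal.ofReal (u ^ (-a)) := by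
        rw [← lintegral_const_mul' _ _ ENNReal.ofReal_ne_top]
        refine setLIntegral_congr_fun measurableSet_Ioi fun u (hu : 0 < u) => ?_
        have hexp : (1 - 2) / a⁻¹ = -a := by field_simp; norm_num
        have hone : (2 - 1 : ℝ) = 1 := by norm_num
        rw [hexp, hone, div_one, Real.div_rpow hu.le hc.le, Real.rpow_neg hc.le, div_inv_eq_mul,
          mul_comm (u ^ (-a)), ENNReal.ofReal_mul (by positivity), mul_left_comm]
    _ = _ := by
        rw [lintegral_poissonMeasure_Ici_mul_rpow hn ha hna, ← ENNReal.ofReal_mul (by positivity)]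

end PowerWeights

section RandomSections

variable {α β : Type*} [MeasurableSpace α] [MeasurableSpace β] {T : Set (α × β)} {w : β → ℝ≥0∞}

theorem measurable_lintegral_indicator_section (hT : MeasurableSet T) (hw : Measurable w)
    (ν : Measure β) [SFinite ν] :
    Measurable fun x => ∫⁻ y, {y | (x, y) ∈ T}.indicator w y ∂ν :=
  ((hw.comp measurable_snd).indicator hT).lintegral_prod_right'

theorem lintegral_lintegral_indicator_section (hT : MeasurableSet T) (hw : Measurable w)
    (μ : Measure α) (ν : Measure β) [SFinite μ] [SFinite ν] :
    ∫⁻ x, ∫⁻ y, {y | (x, y) ∈ T}.indicator w y ∂ν ∂μ = ∫⁻ y, μ {x | (x, y) ∈ T} * w y ∂ν := by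
  calc ∫⁻ x, ∫⁻ y, {y | (x, y) ∈ T}.indicator w y ∂ν ∂μ
      = ∫⁻ y, ∫⁻ x, {x | (x, y) ∈ T}.indicator (fun _ => w y) x ∂μ ∂ν :=
        lintegral_lintegral_swap ((hw.comp measurable_snd).indicator hT).aemeasurable
    _ = ∫⁻ y, μ {x | (x, y) ∈ T} * w y ∂ν := lintegral_congr fun y =>
        (lintegral_indicator_const (measurable_prodMk_right hT) _).trans (mul_comm _ _)

end RandomSections

section ArrivalTimes

/-- The `k`-th arrival time of a counting function `N`: the infimum of the times by which `N` has
reached `k`. If `N` never reaches `k`, this is `sInf ∅ = 0`. -/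
def arrivalTime (N : ℝ → ℕ∞) (k : ℕ) : ℝ := sInf {t | (k : ℕ∞) ≤ N t}

theorem ofReal_inv_sInf_eq_lintegral {S : Set ℝ} (hup : IsUpperSet S) (hne : S.Nonempty) {ε : ℝ}
    (hε : 0 < ε) (hεS : ε ∉ S) :
    ENNReal.ofReal (sInf S)⁻¹ =
      ∫⁻ t in Set.Ioi 0, S.indicator (fun t => ENNReal.ofReal (t ^ (-2 : ℝ))) t := by
  have hlower : ∀ t ∈ S, ε ≤ t := fun t ht => le_of_not_ge fun htε => hεS (hup htε ht)
  have hpos : 0 < sInf S := hε.trans_le (le_csInf hne hlower)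
  have hIoi : Set.Ioi (sInf S) ⊆ S := fun t ht =>
    let ⟨_, hu, hut⟩ := exists_lt_of_csInf_lt hne ht
    hup hut.le hu
  have hIci : S ⊆ Set.Ici (sInf S) := fun t ht => csInf_le ⟨ε, hlower⟩ ht
  have hae : S =ᵐ[volume] Set.Ici (sInf S) :=
    hIci.eventuallyLE.antisymm (Ioi_ae_eq_Ici.symm.le.trans hIoi.eventuallyLE)
  have hinter : S ∩ Set.Ioi 0 = S := Set.inter_eq_left.2 fun t ht => hε.trans_le (hlower t ht)
  rw [setLIntegral_indicator hup.ordConnected.measurableSet, hinter, setLIntegral_congr hae,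
    setLIntegral_Ici_rpow hpos one_lt_two]
  norm_num [Real.rpow_neg_one]

theorem ofReal_inv_arrivalTime_eq_lintegral {N : ℝ → ℕ∞} (hN : Monotone N) {k : ℕ}
    (hreach : ∃ t, (k : ℕ∞) ≤ N t) {ε : ℝ} (hε : 0 < ε) (hεk : N ε < k) :
    ENNReal.ofReal (arrivalTime N k)⁻¹ =
      ∫⁻ t in Set.Ioi 0,
        {t | (k : ℕ∞) ≤ N t}.indicator (fun t => ENNReal.ofReal (t ^ (-2 : ℝ))) t :=
  ofReal_inv_sInf_eq_lintegral (fun _ _ hst hs => le_trans hs (hN hst)) hreach hε hεk.not_ge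

variable {Ω : Type*} [MeasurableSpace Ω] {P : Measure Ω}

section PoissonMarginal

variable {Y : Ω → ℕ∞} {r : ℝ≥0}

theorem measure_natCast_le_of_hasLaw_poissonMeasure (hY : HasLaw Y Po(ℕ∞, r) P) (k : ℕ) :
    P {ω | (k : ℕ∞) ≤ Y ω} = Po(r) (Set.Ici k) := by
  rw [hY.measure_eq (p := fun y => (k : ℕ∞) ≤ y) .of_discrete,
    Measure.map_apply .of_discrete .of_discrete]
  congr 1
  ext j
  simp

theorem measure_lt_natCast_of_hasLaw_poissonMeasure (hY : HasLaw Y Po(ℕ∞, r) P) (k : ℕ) :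
    P {ω | Y ω < k} = Po(r) (Set.Iio k) := by
  rw [hY.measure_eq (p := fun y => y < (k : ℕ∞)) .of_discrete,
    Measure.map_apply .of_discrete .of_discrete]
  congr 1
  ext j
  simp

end PoissonMarginal

variable {N : ℝ → Ω → ℕ∞} {m : ℝ → ℝ≥0}

theorem ae_exists_natCast_le_of_hasLaw_poissonMeasure
    (hlaw : ∀ t, 0 < t → HasLaw (N t) Po(ℕ∞, m t) P) (htop : Tendsto m atTop atTop) (k : ℕ) :
    ∀ᵐ ω ∂P, ∃ t, (k : ℕ∞) ≤ N t ω := by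
  simp only [ae_iff, not_exists, not_le]
  refine le_antisymm
    (ge_of_tendsto ((tendsto_poissonMeasure_Iio_atTop k).comp htop) ?_) zero_le
  filter_upwards [eventually_gt_atTop 0] with t ht
  rw [Function.comp_apply, ← measure_lt_natCast_of_hasLaw_poissonMeasure (hlaw t ht)]
  exact measure_mono fun ω hω => hω t

theorem ae_exists_lt_one_of_hasLaw_poissonMeasure
    (hlaw : ∀ t, 0 < t → HasLaw (N t) Po(ℕ∞, m t) P) (hzero : Tendsto m (𝓝[>] 0) (𝓝 0)) :
    ∀ᵐ ω ∂P, ∃ ε, 0 < ε ∧ N ε ω < 1 := by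
  simp only [ae_iff, not_exists, not_and, not_lt]
  refine le_antisymm (ge_of_tendsto (ENNReal.tendsto_coe.2 hzero) ?_) zero_le
  filter_upwards [self_mem_nhdsWithin] with t (ht : 0 < t)
  calc P {ω | ∀ ε, 0 < ε → 1 ≤ N ε ω} ≤ P {ω | ((1 : ℕ) : ℕ∞) ≤ N t ω} :=
        measure_mono fun ω hω => by simpa using hω t ht
    _ ≤ m t := by
        rw [measure_natCast_le_of_hasLaw_poissonMeasure (hlaw t ht)]
        exact poissonMeasure_Ici_succ_le (m t) 0

theorem ae_ofReal_inv_arrivalTime_eq_lintegral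
    (hlaw : ∀ t, 0 < t → HasLaw (N t) Po(ℕ∞, m t) P) (hmono : Monotone N)
    (htop : Tendsto m atTop atTop) (hzero : Tendsto m (𝓝[>] 0) (𝓝 0)) {k : ℕ} (hk : 1 ≤ k) :
    (fun ω => ENNReal.ofReal (arrivalTime (N · ω) k)⁻¹) =ᵐ[P]
      fun ω => ∫⁻ t in Set.Ioi 0,
        {t | (k : ℕ∞) ≤ N t ω}.indicator (fun t => ENNReal.ofReal (t ^ (-2 : ℝ))) t := by
  filter_upwards [ae_exists_natCast_le_of_hasLaw_poissonMeasure hlaw htop k,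
    ae_exists_lt_one_of_hasLaw_poissonMeasure hlaw hzero] with ω hreach ⟨ε, hε, hε1⟩
  exact ofReal_inv_arrivalTime_eq_lintegral (fun s t hst => hmono hst ω) hreach hε
    (hε1.trans_le (by exact_mod_cast hk))

theorem aemeasurable_ofReal_inv_arrivalTime
    (hlaw : ∀ t, 0 < t → HasLaw (N t) Po(ℕ∞, m t) P)
    (hN : Measurable fun z : Ω × ℝ => N z.2 z.1) (hmono : Monotone N)
    (htop : Tendsto m atTop atTop) (hzero : Tendsto m (𝓝[>] 0) (𝓝 0)) {k : ℕ} (hk : 1 ≤ k) :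
    AEMeasurable (fun ω => ENNReal.ofReal (arrivalTime (N · ω) k)⁻¹) P :=
  (measurable_lintegral_indicator_section (hN (.of_discrete (s := Set.Ici (k : ℕ∞))))
    (w := fun t => ENNReal.ofReal (t ^ (-2 : ℝ))) (by fun_prop)
    (volume.restrict (Set.Ioi 0))).aemeasurable.congr
      (ae_ofReal_inv_arrivalTime_eq_lintegral hlaw hmono htop hzero hk).symm

theorem lintegral_ofReal_inv_arrivalTime [SFinite P]
    (hlaw : ∀ t, 0 < t → HasLaw (N t) Po(ℕ∞, m t) P)
    (hN : Measurable fun z : Ω × ℝ => N z.2 z.1) (hmono : Monotone N)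
    (htop : Tendsto m atTop atTop) (hzero : Tendsto m (𝓝[>] 0) (𝓝 0)) {k : ℕ} (hk : 1 ≤ k) :
    ∫⁻ ω, ENNReal.ofReal (arrivalTime (N · ω) k)⁻¹ ∂P =
      ∫⁻ t in Set.Ioi 0, Po(m t) (Set.Ici k) * ENNReal.ofReal (t ^ (-2 : ℝ)) := by
  rw [lintegral_congr_ae (ae_ofReal_inv_arrivalTime_eq_lintegral hlaw hmono htop hzero hk)]
  refine (lintegral_lintegral_indicator_section (hN (.of_discrete (s := Set.Ici (k : ℕ∞))))
    (by fun_prop) P _).trans ?_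
  refine setLIntegral_congr_fun measurableSet_Ioi fun t (ht : 0 < t) => ?_
  rw [← measure_natCast_le_of_hasLaw_poissonMeasure (hlaw t ht)]
  rfl

end ArrivalTimes

section PowerLawMean

variable {Ω : Type*} [MeasurableSpace Ω] {P : Measure Ω} [SFinite P] {N : ℝ → Ω → ℕ∞} {a c : ℝ}

theorem lintegral_tsum_ofReal_inv_arrivalTime_of_rpow
    (hlaw : ∀ t, 0 < t → HasLaw (N t) Po(ℕ∞, (c * t ^ a⁻¹).toNNReal) P)
    (hN : Measurable fun z : Ω × ℝ => N z.2 z.1) (hmono : Monotone N)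
    (ha : 1 < a) (hc : 0 < c) {n : ℕ} (hn : 1 ≤ n) (hna : a < n + 1) :
    AEMeasurable (fun ω => ∑' k, ENNReal.ofReal (arrivalTime (N · ω) (n + 1 + k))⁻¹) P ∧
      ∫⁻ ω, ∑' k, ENNReal.ofReal (arrivalTime (N · ω) (n + 1 + k))⁻¹ ∂P =
        ENNReal.ofReal (c ^ a * ((a - 1)⁻¹ * (Real.Gamma (n + 1 - a) / Real.Gamma n))) := by
  have ha' : 0 < a⁻¹ := by positivity
  have htop : Tendsto (fun t : ℝ => (c * t ^ a⁻¹).toNNReal) atTop atTop :=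
    tendsto_real_toNNReal_atTop.comp ((tendsto_rpow_atTop ha').const_mul_atTop hc)
  have hzero : Tendsto (fun t : ℝ => (c * t ^ a⁻¹).toNNReal) (𝓝[>] 0) (𝓝 0) := by
    have hcont : ContinuousAt (fun t : ℝ => (c * t ^ a⁻¹).toNNReal) 0 :=
      continuous_real_toNNReal.continuousAt.comp
        ((Real.continuousAt_rpow_const 0 _ (Or.inr ha'.le)).const_mul c)
    have := hcont.tendsto
    rw [Real.zero_rpow ha'.ne', mul_zero, Real.toNNReal_zero] at this
    exact this.mono_left nhdsWithin_le_nhds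
  have hmeas (k : ℕ) := aemeasurable_ofReal_inv_arrivalTime hlaw hN hmono htop hzero
    (k := n + 1 + k) (by omega)
  refine ⟨.tsum hmeas, ?_⟩
  rw [lintegral_tsum hmeas, ← lintegral_tsum_poissonMeasure_Ici_mul_rpow hn ha hna hc]
  have hmeas_tail (k : ℕ) : Measurable fun t : ℝ =>
      Po((c * t ^ a⁻¹).toNNReal) (Set.Ici (n + 1 + k)) * ENNReal.ofReal (t ^ (-2 : ℝ)) :=
    ((measurable_poissonMeasure_apply _).comp (by fun_prop)).mul (by fun_prop)
  simp only [← ENNReal.tsum_mul_right]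
  rw [lintegral_tsum fun k => (hmeas_tail k).aemeasurable]
  exact tsum_congr fun k => lintegral_ofReal_inv_arrivalTime hlaw hN hmono htop hzero (by omega)

end PowerLawMean

section HeardCount

variable {Ω : Type*} {α φ lam : ℝ} {x : Plane} {X : ℕ → Ω → Plane} {h : ℕ → Ω → ℝ}

/-- The number of heard nodes whose inverse interference power at `x` is at most `t`, as a process
in the time `t`: its arrival times are the inverses of the dominant interference powers. -/
def heardCount (α φ : ℝ) (x : Plane) (X : ℕ → Ω → Plane) (h : ℕ → Ω → ℝ) (t : ℝ) : Ω → ℕ∞ :=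
  pointCount (fun i ω => (X i ω, h i ω)) (heardRegion α φ x t)

theorem partialInterference_eq_tsum_arrivalTime (ω : Ω) (n : ℕ) :
    partialInterference α φ x (fun i => X i ω) (fun i => h i ω) n =
      ∑' k, ENNReal.ofReal (arrivalTime (heardCount α φ x X h · ω) (n + 1 + k))⁻¹ :=
  rfl

theorem monotone_heardCount : Monotone (heardCount α φ x X h) := fun _ _ hst _ =>
  Set.encard_le_encard fun _ hi => ⟨hi.1, hi.2.trans hst⟩

variable [MeasurableSpace Ω]

theorem measurable_heardCount (hX : ∀ i, Measurable (X i)) (h_meas : ∀ i, Measurable (h i)) :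
    Measurable fun z : Ω × ℝ => heardCount α φ x X h z.2 z.1 :=
  measurable_pointCount (X := fun i (z : Ω × ℝ) => (z.2, X i z.1, h i z.1))
    (fun i => measurable_snd.prodMk
      (((hX i).comp measurable_fst).prodMk ((h_meas i).comp measurable_fst)))
    (measurableSet_mem_heardRegion α φ x)

theorem hasLaw_heardCount {P : Measure Ω} (hα : 0 < α) (hφ_pos : 0 < φ) (hφ_le : φ ≤ 2 * Real.pi)
    (hX : IsPoissonPointProcess X (ENNReal.ofReal lam • volume) P) (h_meas : ∀ i, Measurable (h i))
    (h_pos : ∀ᵐ ω ∂P, 0 < h 0 ω) (h_indep : iIndepFun h P)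
    (h_ident : ∀ i, IdentDistrib (h i) (h 0) P P)
    (h_moment : Integrable (fun ω => h 0 ω ^ (2 / α)) P)
    (hXh : IndepFun (fun ω i => X i ω) (fun ω i => h i ω) P) {t : ℝ} (ht : 0 ≤ t) :
    HasLaw (heardCount α φ x X h t)
      Po(ℕ∞, ((∫ ω, h 0 ω ^ (2 / α) ∂P) * φ * lam / 2 * t ^ (2 / α)).toNNReal) P := by
  have := hX.isProbabilityMeasure
  have h_aemeas : AEMeasurable (h 0) P := (h_meas 0).aemeasurable
  have := Measure.isProbabilityMeasure_map (μ := P) h_aemeas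
  have hrpow : AEStronglyMeasurable (fun m : ℝ => m ^ (2 / α)) (P.map (h 0)) := by fun_prop
  have hmean := prod_heardRegion (lam := lam) hα hφ_pos hφ_le x (P.map (h 0))
    ((ae_map_iff h_aemeas measurableSet_Ioi).2 h_pos)
    ((integrable_map_measure hrpow h_aemeas).2 h_moment) ht
  rw [integral_map h_aemeas hrpow] at hmean
  have hlaw := hX.hasLaw_pointCount_mark h_meas h_indep
    (fun i => ⟨(h_meas i).aemeasurable, (h_ident i).map_eq⟩) hXh
    (measurableSet_heardRegion α φ x t) (hmean ▸ ENNReal.ofReal_ne_top)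
  rwa [hmean] at hlaw

end HeardCount

theorem integral_pos_of_ae_pos {α : Type*} [MeasurableSpace α] {μ : Measure α} [NeZero μ]
    {f : α → ℝ} (hf : ∀ᵐ x ∂μ, 0 < f x) (hint : Integrable f μ) : 0 < ∫ x, f x ∂μ := by
  have hsupport : Function.support f =ᵐ[μ] Set.univ :=
    eventuallyEq_univ.2 (hf.mono fun _ hx => hx.ne')
  rw [integral_pos_iff_support_of_nonneg_ae (hf.mono fun _ hx => hx.le) hint,
    measure_congr hsupport]
  exact NeZero.pos _

theorem mainTheorem5 {Ω : Type*} [MeasurableSpace Ω] (P : Measure Ω) [IsProbabilityMeasure P]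
    (α φ lam : ℝ) (hα : 2 < α) (hφ_pos : 0 < φ) (hφ_le : φ ≤ 2 * Real.pi) (hlam : 0 < lam)
    (x : Plane)
    (X : ℕ → Ω → Plane)
    (hX : IsPoissonPointProcess X (ENNReal.ofReal lam • (volume : Measure Plane)) P)
    (h : ℕ → Ω → ℝ)
    (h_meas : ∀ i, Measurable (h i))
    (h_pos : ∀ i, ∀ᵐ ω ∂P, 0 < h i ω)
    (h_indep : iIndepFun h P)
    (h_ident : ∀ i, IdentDistrib (h i) (h 0) P P)
    (h_moment : Integrable (fun ω => h 0 ω ^ (2 / α)) P)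
    (hXh : IndepFun (fun ω i => X i ω) (fun ω i => h i ω) P)
    (n : ℕ) (hn : 1 ≤ n) (hnα : α / 2 < n + 1) :
    AEMeasurable
        (fun ω => partialInterference α φ x (fun i => X i ω) (fun i => h i ω) n) P ∧
      ∫⁻ ω, partialInterference α φ x (fun i => X i ω) (fun i => h i ω) n ∂P =
        ENNReal.ofReal
          (2 / (α - 2) * ((∫ ω, h 0 ω ^ (2 / α) ∂P) * φ * lam / 2) ^ (α / 2) *
            (Real.Gamma (n + 1 - α / 2) / Real.Gamma n)) := by
  have hα0 : 0 < α := by linarith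
  have hmean_pos : 0 < ∫ ω, h 0 ω ^ (2 / α) ∂P :=
    integral_pos_of_ae_pos ((h_pos 0).mono fun ω hω => Real.rpow_pos_of_pos hω _) h_moment
  have hlaw (t : ℝ) (ht : 0 < t) := hasLaw_heardCount (x := x) hα0 hφ_pos hφ_le hX h_meas
    (h_pos 0) h_indep h_ident h_moment hXh ht.le
  have hconst : 2 / (α - 2) = (α / 2 - 1)⁻¹ := by rw [div_sub_one two_ne_zero, inv_div]
  have hN := measurable_heardCount (α := α) (φ := φ) (x := x) hX.measurable_point h_meas
  simp only [partialInterference_eq_tsum_arrivalTime]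
  rw [mul_comm (2 / (α - 2)), mul_assoc, hconst]
  rw [← inv_div α 2] at hlaw hmean_pos ⊢
  exact lintegral_tsum_ofReal_inv_arrivalTime_of_rpow hlaw hN monotone_heardCount (by linarith)
    (by positivity) hn hnα

end
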